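/- Let $L$ be a finite-dimensional nonabelian nilpotent Lie algebra over an arbitrary field $F$, with $\dim_F L\le 6$. Then the nonabelian exterior square $L\wedge L$ is capable, that is, there is a Lie algebra $E$ over $F$ with $L\wedge L\cong E/Z(E)$, where $Z(E)$ is the centre of $E$. Here the nonabelian tensor square $L\otimes L$ is the Lie algebra over $F$ generated by symbols $l\otimes k$ ($l,k\in L$) subject to the relations $$c(l\otimes k)=cl\otimes k=l\otimes ck,\quad (l+l')\otimes k=l\otimes k+l'\otimes k,\quad l\otimes(k+k')=l\otimes k+l\otimes k',$$ $$[l,l']\otimes k=l\otimes[l',k]-l'\otimes[l,k],\quad l\otimes[k,k']=[k',l]\otimes k-[k,l]\otimes k',\quad [l\otimes k,\,l'\otimes k']=-[k,l]\otimes[l',k']$$ for $c\in F$ and $l,l',k,k'\in L$, and the nonabelian exterior square is $L\wedge L=(L\otimes L)/(L\,\square\,L)$, where $L\,\square\,L$ is the ideal of $L\otimes L$ generated by the elements $l\otimes l$, $l\in L$. (The exterior square $L\wedge L$ itself may be abelian.) -/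

import Mathlib

universe u v

/-- The relators of the nonabelian tensor square of a Lie algebra `L`, which acts on itself by
`ˡk = ⁅l, k⁆`, in the free Lie algebra on the symbols `l ⊗ k`, here the pairs `(l, k)`.
A relation `a = b` is recorded as the relator `a - b`. -/
inductive IsTensorRelator (F : Type u) (L : Type v) [Field F] [LieRing L] [LieAlgebra F L] :
    FreeLieAlgebra F (L × L) → Prop
  | smul_left (c : F) (l k : L) : IsTensorRelator F L
      (c • FreeLieAlgebra.of F (l, k) - FreeLieAlgebra.of F (c • l, k))
  | smul_right (c : F) (l k : L) : IsTensorRelator F L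
      (c • FreeLieAlgebra.of F (l, k) - FreeLieAlgebra.of F (l, c • k))
  | add_left (l l' k : L) : IsTensorRelator F L
      (FreeLieAlgebra.of F (l + l', k) -
        (FreeLieAlgebra.of F (l, k) + FreeLieAlgebra.of F (l', k)))
  | add_right (l k k' : L) : IsTensorRelator F L
      (FreeLieAlgebra.of F (l, k + k') -
        (FreeLieAlgebra.of F (l, k) + FreeLieAlgebra.of F (l, k')))
  | lie_left (l l' k : L) : IsTensorRelator F L
      (FreeLieAlgebra.of F (⁅l, l'⁆, k) -
        (FreeLieAlgebra.of F (l, ⁅l', k⁆) - FreeLieAlgebra.of F (l', ⁅l, k⁆)))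
  | lie_right (l k k' : L) : IsTensorRelator F L
      (FreeLieAlgebra.of F (l, ⁅k, k'⁆) -
        (FreeLieAlgebra.of F (⁅k', l⁆, k) - FreeLieAlgebra.of F (⁅k, l⁆, k')))
  | lie_lie (l k l' k' : L) : IsTensorRelator F L
      (⁅FreeLieAlgebra.of F (l, k), FreeLieAlgebra.of F (l', k')⁆ -
        -FreeLieAlgebra.of F (⁅k, l⁆, ⁅l', k'⁆))

/-- The ideal generated by the relators of the nonabelian tensor square. -/
noncomputable def tensorRelatorIdeal (F : Type u) (L : Type v) [Field F] [LieRing L]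
    [LieAlgebra F L] : LieIdeal F (FreeLieAlgebra F (L × L)) :=
  LieSubmodule.lieSpan F (FreeLieAlgebra F (L × L)) {z | IsTensorRelator F L z}

/-- The nonabelian tensor square `L ⊗ L`. -/
abbrev TensorSquare (F : Type u) (L : Type v) [Field F] [LieRing L] [LieAlgebra F L] :
    Type (max u v) :=
  FreeLieAlgebra F (L × L) ⧸ tensorRelatorIdeal F L

/-- The generator `l ⊗ k` of the nonabelian tensor square. -/
noncomputable def TensorSquare.tmul (F : Type u) {L : Type v} [Field F] [LieRing L]
    [LieAlgebra F L] (l k : L) : TensorSquare F L :=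
  LieSubmodule.Quotient.mk (N := tensorRelatorIdeal F L) (FreeLieAlgebra.of F (l, k))

/-- The diagonal ideal `L □ L` of `L ⊗ L`, generated by the elements `l ⊗ l`. -/
noncomputable def diagonalIdeal (F : Type u) (L : Type v) [Field F] [LieRing L]
    [LieAlgebra F L] : LieIdeal F (TensorSquare F L) :=
  LieSubmodule.lieSpan F (TensorSquare F L) (Set.range fun l : L => TensorSquare.tmul F l l)

/-- The nonabelian exterior square `L ∧ L = (L ⊗ L) / (L □ L)`. -/
abbrev ExteriorSquare (F : Type u) (L : Type v) [Field F] [LieRing L] [LieAlgebra F L] :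
    Type (max u v) :=
  TensorSquare F L ⧸ diagonalIdeal F L

/-- A Lie algebra `L` over `F` is capable if `L ≃ E / Z(E)` for some Lie algebra `E` over `F`.
The universe of `E` is no restriction: in a larger `E`, the subalgebra `E₀` generated by
representatives of the classes in `E / Z(E)` lives in this universe up to isomorphism, and
`E₀ + Z(E) = E`, so that `Z(E₀) = E₀ ∩ Z(E)` and `E₀ / Z(E₀) ≃ E / Z(E)`. -/
def IsCapable (F : Type u) (L : Type v) [Field F] [LieRing L] [LieAlgebra F L] : Prop :=
  ∃ (E : Type (max u v)) (_ : LieRing E) (_ : LieAlgebra F E),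
    Nonempty (L ≃ₗ⁅F⁆ (E ⧸ LieAlgebra.center F E))

/-!
The exterior square `A = L ∧ L` is spanned by the elements `x ∧ y` and carries the commutator
homomorphism `d : A → L`, `x ∧ y ↦ ⁅x, y⁆`, whose image is `L²`. Its bracket is
`⁅a, b⁆ = d a ∧ d b` (`exists_commutatorHom`), and `s ∧ L² = 0` whenever `s` is central in `L`
(`wedge_lie_eq_zero`).

For `L` nilpotent and nonabelian of dimension at most six, this makes `A` small in two ways. The
second derived algebra of `L` is central (`lie_lie_lie_eq_zero_of_finrank_le_six`, by the dimensions
of the lower central series), so `A` has class at most two. Moreover `dim L² ≤ 4`, and `L²` contains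
a nonzero central element `s` of `L`, so the bracket of `A` factors through `L² / ⟨s⟩`, of dimension
at most three. A form `ω = φ ⁅·, ·⁆` on `A`, for a linear functional `φ`, has even rank at most
three, hence rank at most two, that is, it satisfies the Plücker relation (`plucker`).

A Lie algebra is capable as soon as every nonzero central `z` is detected by a scalar 2-cocycle
(`isCapable_of_forall_center`): take the central extension by all cocycles together. If `z` is not
in `⁅A, A⁆`, a product `φ ∧ ψ` of functionals killing `⁅A, A⁆` serves, provided `A` is not spanned
by `z`. If `z ∈ ⁅A, A⁆`, choose `φ z = 1` and an `x` with `ω(x, ·) ≠ 0`; the Plücker relation says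
`ω ∧ ω(x, ·) = 0`, which makes `φ ∧ ω(x, ·)` a cocycle that does not kill `z`
(`isCapable_of_plucker`).

Finally `A` has dimension at least two (`exists_notMem_span_singleton`), as 2-cocycles on `L` are
linear functionals on `A` and `L` has two independent ones.
-/

/-! ### The exterior square: generators, relations and the universal property -/

/-- The Lie bracket as a bilinear map. -/
def lieBilin (F A : Type*) [Field F] [LieRing A] [LieAlgebra F A] : A →ₗ[F] A →ₗ[F] A :=
  LinearMap.mk₂ F (⁅·, ·⁆) add_lie smul_lie lie_add fun c x y => lie_smul c x y

@[simp] lemma lieBilin_apply {F A : Type*} [Field F] [LieRing A] [LieAlgebra F A] (x y : A) :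
    lieBilin F A x y = ⁅x, y⁆ := rfl

namespace ExteriorSquare

section

variable {F : Type u} [Field F] {L : Type v} [LieRing L] [LieAlgebra F L]

variable (F L) in
/-- The projection of the free Lie algebra on the symbols `l ⊗ k` onto `L ∧ L`. -/
noncomputable def mkHom : FreeLieAlgebra F (L × L) →ₗ⁅F⁆ ExteriorSquare F L where
  toLinearMap :=
    (LieSubmodule.Quotient.mk' (diagonalIdeal F L) :
        TensorSquare F L →ₗ[F] ExteriorSquare F L).comp
      (LieSubmodule.Quotient.mk' (tensorRelatorIdeal F L) :
        FreeLieAlgebra F (L × L) →ₗ[F] TensorSquare F L)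
  map_lie' := rfl

variable (F) in
/-- The element `x ∧ y` of the exterior square. -/
noncomputable def wedge (x y : L) : ExteriorSquare F L := mkHom F L (FreeLieAlgebra.of F (x, y))

lemma mkHom_surjective : Function.Surjective (mkHom F L) :=
  (LieSubmodule.Quotient.surjective_mk' (diagonalIdeal F L)).comp
    (LieSubmodule.Quotient.surjective_mk' (tensorRelatorIdeal F L))

lemma mkHom_eq_zero_of_isTensorRelator {z : FreeLieAlgebra F (L × L)}
    (hz : IsTensorRelator F L z) : mkHom F L z = 0 := by
  have h : LieSubmodule.Quotient.mk' (tensorRelatorIdeal F L) z = 0 :=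
    (LieSubmodule.Quotient.mk_eq_zero _).2 (LieSubmodule.subset_lieSpan hz)
  change LieSubmodule.Quotient.mk' (diagonalIdeal F L)
    (LieSubmodule.Quotient.mk' (tensorRelatorIdeal F L) z) = 0
  rw [h, map_zero]

lemma wedge_add_left (x x' y : L) : wedge F (x + x') y = wedge F x y + wedge F x' y := by
  simpa [wedge, sub_eq_zero] using mkHom_eq_zero_of_isTensorRelator (.add_left x x' y)

lemma wedge_add_right (x y y' : L) : wedge F x (y + y') = wedge F x y + wedge F x y' := by
  simpa [wedge, sub_eq_zero] using mkHom_eq_zero_of_isTensorRelator (.add_right x y y')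

lemma wedge_smul_left (c : F) (x y : L) : wedge F (c • x) y = c • wedge F x y := by
  have h := mkHom_eq_zero_of_isTensorRelator (.smul_left c x y)
  rw [map_sub, map_smul, sub_eq_zero] at h
  exact h.symm

lemma wedge_smul_right (c : F) (x y : L) : wedge F x (c • y) = c • wedge F x y := by
  have h := mkHom_eq_zero_of_isTensorRelator (.smul_right c x y)
  rw [map_sub, map_smul, sub_eq_zero] at h
  exact h.symm

lemma wedge_lie_right (x y y' : L) :
    wedge F x ⁅y, y'⁆ = wedge F ⁅y', x⁆ y - wedge F ⁅y, x⁆ y' := by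
  have h := mkHom_eq_zero_of_isTensorRelator (F := F) (.lie_right x y y')
  rw [map_sub, map_sub, sub_eq_zero] at h
  exact h

lemma lie_wedge_wedge (x y x' y' : L) :
    ⁅wedge F x y, wedge F x' y'⁆ = -wedge F ⁅y, x⁆ ⁅x', y'⁆ := by
  have h := mkHom_eq_zero_of_isTensorRelator (F := F) (.lie_lie x y x' y')
  rw [map_sub, map_neg, LieHom.map_lie, sub_eq_zero] at h
  exact h

variable (F L) in
/-- The bilinear map `(x, y) ↦ x ∧ y`. -/
noncomputable def wedgeBilin : L →ₗ[F] L →ₗ[F] ExteriorSquare F L :=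
  LinearMap.mk₂ F (wedge F) wedge_add_left wedge_smul_left wedge_add_right wedge_smul_right

@[simp] lemma wedgeBilin_apply (x y : L) : wedgeBilin F L x y = wedge F x y := rfl

lemma wedge_neg_left (x y : L) : wedge F (-x) y = -wedge F x y :=
  LinearMap.map_neg₂ (wedgeBilin F L) x y

lemma lie_wedge_wedge' (x y x' y' : L) :
    ⁅wedge F x y, wedge F x' y'⁆ = wedge F ⁅x, y⁆ ⁅x', y'⁆ := by
  rw [lie_wedge_wedge, ← lie_skew x y, wedge_neg_left]

/-- The elements `x ∧ y` span the exterior square linearly, because their span is closed under the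
bracket. -/
lemma span_range_wedge :
    Submodule.span F (Set.range fun p : L × L => wedge F p.1 p.2) = ⊤ := by
  let S : LieSubalgebra F (ExteriorSquare F L) :=
    { Submodule.span F (Set.range fun p : L × L => wedge F p.1 p.2) with
      lie_mem' := by
        intro a b ha hb
        change a ∈ Submodule.span F _ at ha
        change b ∈ Submodule.span F _ at hb
        change ⁅a, b⁆ ∈ Submodule.span F _
        induction ha, hb using Submodule.span_induction₂ with
        | mem_mem a b ha hb =>
          obtain ⟨p, rfl⟩ := ha
          obtain ⟨q, rfl⟩ := hb
          exact Submodule.subset_span ⟨(⁅p.1, p.2⁆, ⁅q.1, q.2⁆), (lie_wedge_wedge' ..).symm⟩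
        | zero_left b hb => simp
        | zero_right a ha => simp
        | add_left a a' b _ _ _ h h' => rw [add_lie]; exact add_mem h h'
        | add_right a b b' _ _ _ h h' => rw [lie_add]; exact add_mem h h'
        | smul_left c a b _ _ h => rw [smul_lie]; exact Submodule.smul_mem _ _ h
        | smul_right c a b _ _ h => rw [lie_smul]; exact Submodule.smul_mem _ _ h }
  let g : FreeLieAlgebra F (L × L) →ₗ⁅F⁆ S :=
    FreeLieAlgebra.lift F fun p => ⟨wedge F p.1 p.2, Submodule.subset_span ⟨p, rfl⟩⟩
  have hg : S.incl.comp g = mkHom F L := by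
    ext p
    simp [g, wedge]
  rw [eq_top_iff]
  rintro a -
  obtain ⟨f, rfl⟩ := mkHom_surjective a
  rw [← hg]
  exact (g f).2

/-- Two linear maps out of the exterior square agree if they agree on all `x ∧ y`. -/
lemma linearMap_ext {M : Type*} [AddCommGroup M] [Module F M] {f g : ExteriorSquare F L →ₗ[F] M}
    (h : ∀ x y, f (wedge F x y) = g (wedge F x y)) : f = g :=
  LinearMap.ext_on_range span_range_wedge fun p => h p.1 p.2

/-- The universal property of the exterior square, in the form needed here: if `s : L → E` is
linear and multiplicative up to elements of the centre of `E`, then `x ∧ y ↦ ⁅s x, s y⁆` extends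
to a Lie homomorphism `L ∧ L → E`. -/
lemma exists_lift {E : Type*} [LieRing E] [LieAlgebra F E] (s : L →ₗ[F] E)
    (hs : ∀ (x y : L) (e : E), ⁅s ⁅x, y⁆, e⁆ = ⁅⁅s x, s y⁆, e⁆) :
    ∃ f : ExteriorSquare F L →ₗ⁅F⁆ E, ∀ x y, f (wedge F x y) = ⁅s x, s y⁆ := by
  have hs' (x y : L) (e : E) : ⁅e, s ⁅x, y⁆⁆ = ⁅e, ⁅s x, s y⁆⁆ := by
    rw [← lie_skew, hs, lie_skew]
  let g : FreeLieAlgebra F (L × L) →ₗ⁅F⁆ E := FreeLieAlgebra.lift F fun p => ⁅s p.1, s p.2⁆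
  have hg (x y) : g (.of F (x, y)) = ⁅s x, s y⁆ := by simp [g]
  have hT : tensorRelatorIdeal F L ≤ g.ker := by
    refine LieSubmodule.lieSpan_le.2 fun z hz => ?_
    rw [SetLike.mem_coe, LieHom.mem_ker]
    cases hz with
    | smul_left c l k => simp [hg]
    | smul_right c l k => simp [hg]
    | add_left l l' k => simp [hg]
    | add_right l k k' => simp [hg]
    | lie_left l l' k =>
      simp only [map_sub, hg, hs, hs']
      rw [lie_lie, sub_self]
    | lie_right l k k' =>
      simp only [map_sub, hg, hs, hs', leibniz_lie (s l) (s k) (s k')]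
      rw [← lie_skew (s l) (s k), neg_lie, ← lie_skew (s k) ⁅s l, s k'⁆,
        ← lie_skew (s l) (s k'), neg_lie]
      abel
    | lie_lie l k l' k' =>
      simp only [map_sub, map_neg, LieHom.map_lie, hg, hs, hs']
      rw [← lie_skew (s k) (s l), neg_lie]
      abel
  let g₁ : TensorSquare F L →ₗ[F] E := (tensorRelatorIdeal F L).toSubmodule.liftQ g.toLinearMap
    fun z hz => hT hz
  have hg₁ (z) : g₁ (LieSubmodule.Quotient.mk' (tensorRelatorIdeal F L) z) = g z := rfl
  let g₁' : TensorSquare F L →ₗ⁅F⁆ E :=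
    { g₁ with
      map_lie' := by
        intro a b
        obtain ⟨a, rfl⟩ := LieSubmodule.Quotient.surjective_mk' _ a
        obtain ⟨b, rfl⟩ := LieSubmodule.Quotient.surjective_mk' _ b
        exact g.map_lie a b }
  have hD : diagonalIdeal F L ≤ g₁'.ker := by
    refine LieSubmodule.lieSpan_le.2 ?_
    rintro _ ⟨x, rfl⟩
    exact (LieHom.mem_ker ..).2 ((hg x x).trans (lie_self _))
  let g₂ : ExteriorSquare F L →ₗ[F] E := (diagonalIdeal F L).toSubmodule.liftQ g₁'.toLinearMap
    fun z hz => hD hz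
  exact ⟨{ g₂ with
      map_lie' := by
        intro a b
        obtain ⟨a, rfl⟩ := LieSubmodule.Quotient.surjective_mk' _ a
        obtain ⟨b, rfl⟩ := LieSubmodule.Quotient.surjective_mk' _ b
        exact g₁'.map_lie a b }, hg⟩

/-- The commutator homomorphism `d : L ∧ L → L`, `x ∧ y ↦ ⁅x, y⁆`, together with the formula
`⁅a, b⁆ = d a ∧ d b` for the bracket of the exterior square. -/
lemma exists_commutatorHom : ∃ d : ExteriorSquare F L →ₗ⁅F⁆ L,
    (∀ x y, d (wedge F x y) = ⁅x, y⁆) ∧ ∀ a b, ⁅a, b⁆ = wedge F (d a) (d b) := by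
  obtain ⟨d, hd⟩ := exists_lift (F := F) (LinearMap.id : L →ₗ[F] L) fun _ _ _ => rfl
  refine ⟨d, hd, fun a b => ?_⟩
  have h : lieBilin F (ExteriorSquare F L) =
      (wedgeBilin F L).compl₁₂ d.toLinearMap d.toLinearMap := by
    refine linearMap_ext fun x y => linearMap_ext fun x' y' => ?_
    change ⁅wedge F x y, wedge F x' y'⁆ = wedge F (d (wedge F x y)) (d (wedge F x' y'))
    rw [lie_wedge_wedge', hd, hd]
    rfl
  exact LinearMap.congr_fun (LinearMap.congr_fun h a) b

/-- A central element of `L` has zero wedge with every commutator. -/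
lemma wedge_lie_eq_zero {s : L} (hs : ∀ x : L, ⁅x, s⁆ = 0) (x y : L) :
    wedge F s ⁅x, y⁆ = 0 := by
  have h (k : L) : wedge F 0 k = 0 := LinearMap.map_zero₂ (wedgeBilin F L) k
  rw [wedge_lie_right, hs, hs, h, h, sub_zero]

end

end ExteriorSquare

/-! ### Central extensions by 2-cocycles -/

section CentralExtension

variable {F : Type u} [Field F] {A : Type v} [LieRing A] [LieAlgebra F A]
  {M : Type*} [AddCommGroup M] [Module F M]

/-- A bilinear map `c` on a Lie algebra `A` is a 2-cocycle with values in the trivial module `M`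
if it is alternating and the cyclic sum of `c ⁅x, y⁆ z` vanishes. -/
structure IsTwoCocycle (c : A →ₗ[F] A →ₗ[F] M) : Prop where
  self_eq_zero (x : A) : c x x = 0
  cyclic (x y z : A) : c ⁅x, y⁆ z + c ⁅y, z⁆ x + c ⁅z, x⁆ y = 0

lemma IsTwoCocycle.neg_swap {c : A →ₗ[F] A →ₗ[F] M} (hc : IsTwoCocycle c) (x y : A) :
    -c x y = c y x := by
  have h := hc.self_eq_zero (x + y)
  simp only [map_add, LinearMap.add_apply, hc.self_eq_zero, zero_add, add_zero] at h
  exact neg_eq_of_add_eq_zero_left h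

/-- The central extension of `A` by `M` defined by a 2-cocycle `c`: the vector space `A × M` with
the bracket `⁅(x, m), (y, n)⁆ = (⁅x, y⁆, c x y)`. -/
def CentralExtension {c : A →ₗ[F] A →ₗ[F] M} (_ : IsTwoCocycle c) : Type _ := A × M

namespace CentralExtension

variable {c : A →ₗ[F] A →ₗ[F] M} (hc : IsTwoCocycle c)

instance : AddCommGroup (CentralExtension hc) := inferInstanceAs (AddCommGroup (A × M))

instance : Module F (CentralExtension hc) := inferInstanceAs (Module F (A × M))

/-- The projection of the central extension onto `A`, as a linear map. -/
def fst : CentralExtension hc →ₗ[F] A := LinearMap.fst F A M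

/-- The second coordinate on the central extension. -/
def snd : CentralExtension hc →ₗ[F] M := LinearMap.snd F A M

/-- The linear section `x ↦ (x, 0)`. -/
def inl : A →ₗ[F] CentralExtension hc := LinearMap.inl F A M

variable {hc}

lemma ext {p q : CentralExtension hc} (h₁ : fst hc p = fst hc q) (h₂ : snd hc p = snd hc q) :
    p = q := Prod.ext h₁ h₂

instance : Bracket (CentralExtension hc) (CentralExtension hc) where
  bracket p q := ((⁅fst hc p, fst hc q⁆, c (fst hc p) (fst hc q)) : A × M)

@[simp] lemma fst_lie (p q : CentralExtension hc) : fst hc ⁅p, q⁆ = ⁅fst hc p, fst hc q⁆ := rfl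

@[simp] lemma snd_lie (p q : CentralExtension hc) : snd hc ⁅p, q⁆ = c (fst hc p) (fst hc q) := rfl

@[simp] lemma fst_inl (x : A) : fst hc (inl hc x) = x := rfl

instance : LieRing (CentralExtension hc) where
  add_lie p q r := ext (by simp) (by simp)
  lie_add p q r := ext (by simp) (by simp)
  lie_self p := ext (by simp) (by simp [hc.self_eq_zero])
  leibniz_lie p q r := ext (by simp) (by
    have h := hc.cyclic (fst hc p) (fst hc q) (fst hc r)
    simp only [snd_lie, fst_lie, map_add]
    rw [← hc.neg_swap ⁅fst hc q, fst hc r⁆, ← hc.neg_swap ⁅fst hc p, fst hc r⁆,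
      ← lie_skew (fst hc p) (fst hc r), LinearMap.map_neg₂, neg_neg, neg_eq_iff_add_eq_zero, ← h]
    abel)

instance : LieAlgebra F (CentralExtension hc) where
  lie_smul t p q := ext (by simp) (by simp)

variable (hc) in
/-- The projection of the central extension onto `A`. -/
def fstHom : CentralExtension hc →ₗ⁅F⁆ A := { fst hc with map_lie' := rfl }

end CentralExtension

/-- A Lie algebra is capable if each nonzero central element is detected by a scalar 2-cocycle: in
the central extension defined by all scalar 2-cocycles together, the centre is then exactly the
kernel of the projection. -/
lemma isCapable_of_forall_center
    (h : ∀ z : A, (∀ w : A, ⁅z, w⁆ = 0) → z ≠ 0 →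
      ∃ c : A →ₗ[F] A →ₗ[F] F, IsTwoCocycle c ∧ ∃ w, c z w ≠ 0) : IsCapable F A := by
  let I := {c : A →ₗ[F] A →ₗ[F] F // IsTwoCocycle c}
  let C : A →ₗ[F] A →ₗ[F] (I → F) := LinearMap.mk₂ F (fun x y c => c.1 x y)
    (fun _ _ _ => by ext; simp) (fun _ _ _ => by ext; simp)
    (fun _ _ _ => by ext; simp) (fun _ _ _ => by ext; simp)
  have hC : IsTwoCocycle C :=
    ⟨fun x => funext fun c => c.2.self_eq_zero x, fun x y z => funext fun c => c.2.cyclic x y z⟩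
  refine ⟨CentralExtension hC, inferInstance, inferInstance, ?_⟩
  let f := CentralExtension.fstHom hC
  have hf : Function.Surjective f := fun x => ⟨CentralExtension.inl hC x, rfl⟩
  have hker : f.ker = LieAlgebra.center F (CentralExtension hC) := by
    ext p
    rw [LieHom.mem_ker, LieModule.mem_maxTrivSubmodule]
    constructor
    · intro hp q
      have hp : CentralExtension.fst hC p = 0 := hp
      exact CentralExtension.ext (by simp [hp]) (by simp [hp])
    · intro hp
      have hp' (q : CentralExtension hC) : ⁅p, q⁆ = 0 := by rw [← lie_skew, hp, neg_zero]
      by_contra hne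
      obtain ⟨c, hc, w, hw⟩ := h (CentralExtension.fst hC p)
        (fun w => congrArg (CentralExtension.fst hC) (hp' (CentralExtension.inl hC w))) hne
      exact hw (congrFun (congrArg (CentralExtension.snd hC)
        (hp' (CentralExtension.inl hC w))) ⟨c, hc⟩)
  rw [← hker]
  exact ⟨(f.quotKerEquivRange.trans
    ((LieEquiv.ofEq _ _ (by rw [(f.range_eq_top).2 hf])).trans LieSubalgebra.topEquiv)).symm⟩

/-- The alternating form `φ ∧ ψ`, that is `(x, y) ↦ φ x * ψ y - ψ x * φ y`. -/
def wedgeForm (φ ψ : A →ₗ[F] F) : A →ₗ[F] A →ₗ[F] F :=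
  φ.smulRight ψ - ψ.smulRight φ

@[simp] lemma wedgeForm_apply (φ ψ : A →ₗ[F] F) (x y : A) :
    wedgeForm φ ψ x y = φ x * ψ y - ψ x * φ y := by
  simp [wedgeForm]

/-- `φ ∧ ψ` is a 2-cocycle if `ψ` kills all commutators and `dφ ∧ ψ = 0`. -/
lemma isTwoCocycle_wedgeForm {φ ψ : A →ₗ[F] F} (hψ : ∀ x y : A, ψ ⁅x, y⁆ = 0)
    (h : ∀ x y z : A, φ ⁅x, y⁆ * ψ z + φ ⁅y, z⁆ * ψ x + φ ⁅z, x⁆ * ψ y = 0) :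
    IsTwoCocycle (wedgeForm φ ψ) where
  self_eq_zero x := by simp [mul_comm]
  cyclic x y z := by simpa [hψ] using h x y z

/-- A 2-cocycle on `L` is a linear functional on `L ∧ L`. -/
lemma ExteriorSquare.exists_functional {c : A →ₗ[F] A →ₗ[F] M} (hc : IsTwoCocycle c) :
    ∃ g : ExteriorSquare F A →ₗ[F] M, ∀ x y, g (wedge F x y) = c x y := by
  obtain ⟨f, hf⟩ := exists_lift (CentralExtension.inl hc) fun x y e =>
    CentralExtension.ext (by simp [-lie_lie]) (by simp [-lie_lie])
  exact ⟨CentralExtension.snd hc ∘ₗ f.toLinearMap,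
    fun x y => congrArg (CentralExtension.snd hc) (hf x y)⟩

end CentralExtension

/-! ### A capability criterion for Lie algebras of class at most two -/

section Criterion

variable {F : Type u} [Field F] {A : Type v} [LieRing A] [LieAlgebra F A]

/-- A Lie algebra of class at most two that is not spanned by one element, and all of whose forms
`φ ⁅x, y⁆` have rank at most two (expressed by the Plücker relation), is capable. -/
lemma isCapable_of_plucker (hclass : ∀ a b c : A, ⁅⁅a, b⁆, c⁆ = 0)
    (hdim : ∀ z : A, ∃ w, w ∉ Submodule.span F {z})
    (hpl : ∀ (φ : A →ₗ[F] F) (a b c d : A),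
      φ ⁅a, b⁆ * φ ⁅c, d⁆ - φ ⁅a, c⁆ * φ ⁅b, d⁆ + φ ⁅a, d⁆ * φ ⁅b, c⁆ = 0) :
    IsCapable F A := by
  refine isCapable_of_forall_center fun z hz hz0 => ?_
  set D : Submodule F A := Submodule.span F {m | ∃ x y : A, ⁅x, y⁆ = m} with hD
  have hmem (x y : A) : ⁅x, y⁆ ∈ D := Submodule.subset_span ⟨x, y, rfl⟩
  by_cases hzD : z ∈ D
  · obtain ⟨φ, hφz⟩ := Module.Projective.exists_dual_eq_one F hz0
    obtain ⟨x, y, hxy⟩ : ∃ x y : A, φ ⁅x, y⁆ ≠ 0 := by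
      by_contra! hall
      have hle : D ≤ LinearMap.ker φ := Submodule.span_le.2 (by rintro _ ⟨x, y, rfl⟩; exact hall x y)
      exact one_ne_zero (hφz.symm.trans (hle hzD))
    -- For `ω = dφ` of rank at most two, `ω ∧ ω(x, ·) = 0`, so `φ ∧ ω(x, ·)` is a cocycle.
    refine ⟨wedgeForm φ (φ ∘ₗ lieBilin F A x), isTwoCocycle_wedgeForm (fun a b => ?_)
      fun a b c => ?_, y, ?_⟩
    · rw [LinearMap.comp_apply, lieBilin_apply, ← lie_skew, hclass, neg_zero, map_zero]
    · have h := hpl φ x a b c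
      simp only [LinearMap.comp_apply, lieBilin_apply, ← lie_skew a c, map_neg] at h ⊢
      linear_combination h
    · have hxz : ⁅x, z⁆ = 0 := by rw [← lie_skew, hz, neg_zero]
      simpa [hφz, hxz] using hxy
  · -- Otherwise `A` would be the sum of two central subspaces, hence abelian and spanned by `z`.
    obtain ⟨w, hw⟩ : ∃ w, w ∉ D ⊔ Submodule.span F {z} := by
      by_contra! hall
      have hcen (a b : A) : ⁅a, b⁆ = 0 := by
        obtain ⟨d, hd, t, ht, rfl⟩ := Submodule.mem_sup.1 (hall a)
        obtain ⟨t, rfl⟩ := Submodule.mem_span_singleton.1 ht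
        rw [add_lie, smul_lie, hz, smul_zero, add_zero]
        induction hd using Submodule.span_induction with
        | mem d hd => obtain ⟨x, y, rfl⟩ := hd; exact hclass x y b
        | zero => simp
        | add d e _ _ h h' => rw [add_lie, h, h', add_zero]
        | smul r d _ h => rw [smul_lie, h, smul_zero]
      have hbot : D = ⊥ := by
        refine (Submodule.eq_bot_iff _).2 fun d hd => ?_
        rw [hD, Submodule.span_eq_bot.2] at hd
        · exact hd
        · rintro _ ⟨x, y, rfl⟩
          exact hcen x y
      obtain ⟨w, hw⟩ := hdim z
      exact hw (by simpa [hbot] using hall w)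
    obtain ⟨φ, hφz, hφ⟩ := Submodule.exists_le_ker_of_notMem hzD
    obtain ⟨ψ, hψw, hψ⟩ := Submodule.exists_le_ker_of_notMem hw
    have hψD (x y : A) : ψ ⁅x, y⁆ = 0 := hψ (Submodule.mem_sup_left (hmem x y))
    have hφD (x y : A) : φ ⁅x, y⁆ = 0 := hφ (hmem x y)
    have hψz : ψ z = 0 := hψ (Submodule.mem_sup_right (Submodule.mem_span_singleton_self z))
    exact ⟨wedgeForm φ ψ, isTwoCocycle_wedgeForm hψD (by simp [hφD]), w, by simp [hψz, hφz, hψw]⟩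

end Criterion

/-! ### The lower central series in small dimension -/

section Nilpotent

open LieModule Module

variable {F : Type u} [Field F] {L : Type v} [LieRing L] [LieAlgebra F L]

lemma lie_mem_lowerCentralSeries_succ {k : ℕ} (x : L) {y : L}
    (hy : y ∈ lowerCentralSeries F L L k) : ⁅x, y⁆ ∈ lowerCentralSeries F L L (k + 1) := by
  rw [lowerCentralSeries_succ]
  exact LieSubmodule.lie_mem_lie (LieSubmodule.mem_top x) hy

lemma lowerCentralSeries_succ_le_iff {k : ℕ} {N : LieSubmodule F L L} :
    lowerCentralSeries F L L (k + 1) ≤ N ↔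
      ∀ x : L, ∀ y ∈ lowerCentralSeries F L L k, ⁅x, y⁆ ∈ N := by
  rw [lowerCentralSeries_succ, LieSubmodule.lie_le_iff]
  simp

lemma lie_mem_lowerCentralSeries_one (x y : L) : ⁅x, y⁆ ∈ lowerCentralSeries F L L 1 :=
  lie_mem_lowerCentralSeries_succ x (by simp)

/-- The part `⁅L², γ⁆ ⊆ ⁅L, ⁅L, γ⁆⁆` of the commutator estimate for the lower central series. -/
lemma lie_mem_lowerCentralSeries_add_two {k : ℕ} {x y : L}
    (hx : x ∈ lowerCentralSeries F L L 1) (hy : y ∈ lowerCentralSeries F L L k) :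
    ⁅x, y⁆ ∈ lowerCentralSeries F L L (k + 2) := by
  rw [lowerCentralSeries_succ, lowerCentralSeries_zero, ← LieSubmodule.mem_toSubmodule,
    LieSubmodule.lieIdeal_oper_eq_linear_span'] at hx
  induction hx using Submodule.span_induction with
  | mem x hx =>
    obtain ⟨a, -, b, -, rfl⟩ := hx
    rw [lie_lie]
    exact sub_mem (lie_mem_lowerCentralSeries_succ a (lie_mem_lowerCentralSeries_succ b hy))
      (lie_mem_lowerCentralSeries_succ b (lie_mem_lowerCentralSeries_succ a hy))
  | zero => simp
  | add a b _ _ ha hb => rw [add_lie]; exact add_mem ha hb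
  | smul c a _ ha => rw [smul_lie]; exact (lowerCentralSeries F L L (k + 2)).smul_mem c ha

variable (F) in
lemma lowerCentralSeries_eq_bot_of_le_succ [LieRing.IsNilpotent L] {k : ℕ}
    (h : lowerCentralSeries F L L k ≤ lowerCentralSeries F L L (k + 1)) :
    lowerCentralSeries F L L k = ⊥ := by
  have hle (j : ℕ) : lowerCentralSeries F L L k ≤ lowerCentralSeries F L L (k + j) := by
    induction j with
    | zero => exact le_rfl
    | succ j ih =>
      refine h.trans (lowerCentralSeries_succ_le_iff.2 fun x y hy => ?_)
      exact lie_mem_lowerCentralSeries_succ x (ih hy)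
  obtain ⟨n, hn⟩ := LieModule.IsNilpotent.nilpotent F L L
  rw [eq_bot_iff, ← hn]
  exact (hle n).trans (antitone_lowerCentralSeries F L L (Nat.le_add_left n k))

variable (F) in
lemma lowerCentralSeries_one_ne_bot (h : ¬ IsLieAbelian L) : lowerCentralSeries F L L 1 ≠ ⊥ :=
  fun h' => h ((trivial_iff_lower_central_eq_bot F L L).2 h')

variable (F) in
/-- A nilpotent Lie algebra has no nonzero eigenvector for a nonzero eigenvalue of an inner
derivation. -/
lemma eq_zero_of_lie_eq_smul [LieRing.IsNilpotent L] {x z : L} {r : F} (hz : z ≠ 0)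
    (h : ⁅x, z⁆ = r • z) : r = 0 := by
  by_contra hr
  have hmem (k : ℕ) : z ∈ lowerCentralSeries F L L k := by
    induction k with
    | zero => simp
    | succ k ih =>
      have h1 := (lowerCentralSeries F L L (k + 1)).smul_mem r⁻¹
        (lie_mem_lowerCentralSeries_succ x ih)
      rwa [h, inv_smul_smul₀ hr] at h1
  obtain ⟨n, hn⟩ := LieModule.IsNilpotent.nilpotent F L L
  exact hz (by simpa [hn] using hmem n)

variable (F) in
/-- A nonabelian nilpotent Lie algebra contains a nonzero central element of `L²`. -/
lemma exists_central_mem_lowerCentralSeries_one [LieRing.IsNilpotent L] (h : ¬ IsLieAbelian L) :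
    ∃ s ∈ lowerCentralSeries F L L 1, s ≠ 0 ∧ ∀ x : L, ⁅x, s⁆ = 0 := by
  have : Nontrivial L := by
    by_contra hn
    rw [not_nontrivial_iff_subsingleton] at hn
    exact h ⟨fun x y => Subsingleton.elim _ _⟩
  have := nontrivial_lowerCentralSeriesLast F L L
  obtain ⟨⟨s, hs⟩, hs0⟩ := exists_ne (0 : lowerCentralSeriesLast F L L)
  exact ⟨s, lowerCentralSeriesLast_le_of_not_isTrivial F L L h hs, by simpa using hs0,
    (mem_maxTrivSubmodule ..).1 (lowerCentralSeriesLast_le_max_triv F L L hs)⟩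

/-- If `L` is generated by two elements modulo `L²`, then `L²` is generated by one element modulo
the next term of the lower central series. -/
lemma exists_smul_sub_mem_of_span_pair_sup (x y : L)
    (hxy : Submodule.span F {x, y} ⊔ (lowerCentralSeries F L L 1).toSubmodule = ⊤) {s : L}
    (hs : s ∈ lowerCentralSeries F L L 1) :
    ∃ r : F, s - r • ⁅x, y⁆ ∈ lowerCentralSeries F L L 2 := by
  have hdec (a : L) : ∃ α β : F, ∃ t ∈ lowerCentralSeries F L L 1, a = α • x + β • y + t := by
    obtain ⟨p, hp, t, ht, rfl⟩ := Submodule.mem_sup.1 (hxy ▸ Submodule.mem_top (x := a))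
    obtain ⟨α, β, rfl⟩ := Submodule.mem_span_pair.1 hp
    exact ⟨α, β, t, ht, rfl⟩
  rw [lowerCentralSeries_succ, lowerCentralSeries_zero, ← LieSubmodule.mem_toSubmodule,
    LieSubmodule.lieIdeal_oper_eq_linear_span'] at hs
  induction hs using Submodule.span_induction with
  | mem s hs =>
    obtain ⟨a, -, b, -, rfl⟩ := hs
    obtain ⟨α, β, t, ht, rfl⟩ := hdec a
    obtain ⟨α', β', t', ht', hb⟩ := hdec b
    refine ⟨α * β' - β * α', ?_⟩
    have h1 := lie_mem_lowerCentralSeries_succ (α • x + β • y) ht'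
    have h2 := lie_mem_lowerCentralSeries_succ b ht
    have h3 : ⁅α • x + β • y + t, b⁆ - (α * β' - β * α') • ⁅x, y⁆ =
        ⁅α • x + β • y, t'⁆ - ⁅b, t⁆ := by
      rw [add_lie, ← lie_skew t b, hb]
      simp only [lie_add, add_lie, lie_smul, smul_lie, lie_self, ← lie_skew y x]
      module
    rw [h3]
    exact sub_mem h1 h2
  | zero => exact ⟨0, by simp⟩
  | add a b _ _ ha hb =>
    obtain ⟨r, hr⟩ := ha
    obtain ⟨r', hr'⟩ := hb
    exact ⟨r + r', by convert add_mem hr hr' using 1; module⟩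
  | smul c a _ ha =>
    obtain ⟨r, hr⟩ := ha
    refine ⟨c * r, ?_⟩
    rw [mul_smul, ← smul_sub]
    exact (lowerCentralSeries F L L 2).smul_mem c hr

/-- A vector space of dimension at most two modulo `p` is spanned by two elements modulo `p`. -/
lemma exists_span_pair_sup_eq_top {V : Type*} [AddCommGroup V] [Module F V]
    [FiniteDimensional F V] {p : Submodule F V} (h : finrank F V ≤ finrank F p + 2) :
    ∃ x y, Submodule.span F {x, y} ⊔ p = ⊤ := by
  have step {q : Submodule F V} : ∃ x, q = ⊤ ∨
      finrank F q + 1 ≤ finrank F (Submodule.span F {x} ⊔ q : Submodule F V) := by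
    by_cases hq : q = ⊤
    · exact ⟨0, .inl hq⟩
    · obtain ⟨x, hx⟩ : ∃ x, x ∉ q := by
        by_contra! hall
        exact hq (eq_top_iff.2 fun x _ => hall x)
      refine ⟨x, .inr (Submodule.finrank_lt_finrank_of_lt (lt_of_le_not_ge le_sup_right ?_))⟩
      exact fun hle => hx (hle (Submodule.mem_sup_left (Submodule.mem_span_singleton_self x)))
  obtain ⟨y, hy⟩ := step (q := p)
  obtain ⟨x, hx⟩ := step (q := Submodule.span F {y} ⊔ p)
  refine ⟨x, y, ?_⟩
  rw [Submodule.span_insert, sup_assoc]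
  rcases hy with rfl | hy
  · simp
  rcases hx with hx | hx
  · rw [hx, sup_top_eq]
  · refine Submodule.eq_top_of_finrank_eq (le_antisymm (Submodule.finrank_le _) ?_)
    omega

variable [FiniteDimensional F L] [LieRing.IsNilpotent L]

variable (F) in
lemma finrank_lowerCentralSeries_succ_lt {k : ℕ} (h : lowerCentralSeries F L L k ≠ ⊥) :
    finrank F (lowerCentralSeries F L L (k + 1)) < finrank F (lowerCentralSeries F L L k) := by
  refine Submodule.finrank_lt_finrank_of_lt (lt_of_le_not_ge
    (antitone_lowerCentralSeries F L L k.le_succ) fun hle => h ?_)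
  exact lowerCentralSeries_eq_bot_of_le_succ F hle

lemma lowerCentralSeries_add_eq_bot_of_finrank_le {k n : ℕ}
    (h : finrank F (lowerCentralSeries F L L k) ≤ n) :
    lowerCentralSeries F L L (k + n) = ⊥ := by
  induction n generalizing k with
  | zero =>
    have h0 : (lowerCentralSeries F L L k).toSubmodule = ⊥ :=
      Submodule.finrank_eq_zero.1 (Nat.le_zero.1 h)
    simpa using h0
  | succ n ih =>
    by_cases hk : lowerCentralSeries F L L k = ⊥
    · rw [eq_bot_iff, ← hk]
      exact antitone_lowerCentralSeries F L L (Nat.le_add_right _ _)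
    · have := finrank_lowerCentralSeries_succ_lt F hk
      rw [show k + (n + 1) = k + 1 + n by omega]
      exact ih (by omega)

/-- A nonabelian nilpotent Lie algebra needs at least two generators: `dim L/L² ≥ 2`. -/
lemma finrank_lowerCentralSeries_one_add_two_le (h : ¬ IsLieAbelian L) :
    finrank F (lowerCentralSeries F L L 1) + 2 ≤ finrank F L := by
  by_contra! hlt
  -- With one generator, the pair of generators can be taken as `0, x`, so `L² ⊆ ⁅L, L²⁆`.
  have hx : ∃ x, Submodule.span F {0, x} ⊔ (lowerCentralSeries F L L 1).toSubmodule = ⊤ := by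
    by_cases hq : (lowerCentralSeries F L L 1).toSubmodule = ⊤
    · exact ⟨0, by rw [hq, sup_top_eq]⟩
    · obtain ⟨x, hx⟩ : ∃ x, x ∉ (lowerCentralSeries F L L 1).toSubmodule := by
        by_contra! hall
        exact hq (eq_top_iff.2 fun x _ => hall x)
      refine ⟨x, Submodule.eq_top_of_finrank_eq (le_antisymm (Submodule.finrank_le _) ?_)⟩
      have hlt' : (lowerCentralSeries F L L 1).toSubmodule <
          Submodule.span F {0, x} ⊔ (lowerCentralSeries F L L 1).toSubmodule :=
        lt_of_le_not_ge le_sup_right fun hle =>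
          hx (hle (Submodule.mem_sup_left (Submodule.subset_span (by simp))))
      have := Submodule.finrank_lt_finrank_of_lt hlt'
      change finrank F (lowerCentralSeries F L L 1) < _ at this
      omega
  obtain ⟨x, hx⟩ := hx
  refine lowerCentralSeries_one_ne_bot F h (lowerCentralSeries_eq_bot_of_le_succ F fun s hs => ?_)
  obtain ⟨r, hr⟩ := exists_smul_sub_mem_of_span_pair_sup 0 x hx hs
  simpa using hr

/-- In a nilpotent Lie algebra of dimension at most six, the second derived algebra is central. -/
lemma lie_lie_lie_eq_zero_of_finrank_le_six (h : ¬ IsLieAbelian L) (hdim : finrank F L ≤ 6)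
    (x : L) {s t : L} (hs : s ∈ lowerCentralSeries F L L 1)
    (ht : t ∈ lowerCentralSeries F L L 1) : ⁅x, ⁅s, t⁆⁆ = 0 := by
  have h2 := finrank_lowerCentralSeries_one_add_two_le (F := F) h
  by_cases h3 : finrank F (lowerCentralSeries F L L 1) ≤ 3
  · have hbot := lowerCentralSeries_add_eq_bot_of_finrank_le h3
    have hmem := lie_mem_lowerCentralSeries_succ x (lie_mem_lowerCentralSeries_add_two hs ht)
    rwa [hbot, LieSubmodule.mem_bot] at hmem
  · -- Here `L` has two generators `a, b`, and `⁅⁅a, b⁆, ⁅a, b⁆⁆ = 0` gains one more degree.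
    have hbot := lowerCentralSeries_add_eq_bot_of_finrank_le
      (show finrank F (lowerCentralSeries F L L 1) ≤ 4 by omega)
    obtain ⟨a, b, hab⟩ := exists_span_pair_sup_eq_top
      (p := (lowerCentralSeries F L L 1).toSubmodule)
      (show finrank F L ≤ finrank F (lowerCentralSeries F L L 1) + 2 by omega)
    obtain ⟨r, hr⟩ := exists_smul_sub_mem_of_span_pair_sup a b hab hs
    obtain ⟨r', hr'⟩ := exists_smul_sub_mem_of_span_pair_sup a b hab ht
    have hst : ⁅s, t⁆ = ⁅s, t - r' • ⁅a, b⁆⁆ - ⁅r' • ⁅a, b⁆, s - r • ⁅a, b⁆⁆ := by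
      simp only [lie_sub, lie_smul, smul_lie, lie_self, smul_zero, sub_zero, ← lie_skew s ⁅a, b⁆]
      module
    have hmem : ⁅s, t⁆ ∈ lowerCentralSeries F L L 4 := by
      rw [hst]
      exact sub_mem (lie_mem_lowerCentralSeries_add_two hs hr')
        (lie_mem_lowerCentralSeries_add_two
          ((lowerCentralSeries F L L 1).smul_mem r' (lie_mem_lowerCentralSeries_one a b)) hr)
    have hmem' := lie_mem_lowerCentralSeries_succ x hmem
    rwa [hbot, LieSubmodule.mem_bot] at hmem'

end Nilpotent

/-! ### Capability of the exterior square -/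

section ExteriorSquareCapable

open LieModule Module ExteriorSquare

variable {F : Type u} [Field F] {L : Type v} [LieRing L] [LieAlgebra F L]

/-- The exterior square of a nonabelian nilpotent Lie algebra is not spanned by one element. -/
lemma ExteriorSquare.exists_notMem_span_singleton [LieRing.IsNilpotent L]
    (h : ¬ IsLieAbelian L) (e : ExteriorSquare F L) : ∃ w, w ∉ Submodule.span F {e} := by
  by_contra! hall
  obtain ⟨x, y, hz⟩ : ∃ x y : L, ⁅x, y⁆ ≠ 0 := by
    by_contra! hxy
    exact h ⟨hxy⟩
  obtain ⟨d, hd, -⟩ := exists_commutatorHom (F := F) (L := L)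
  obtain ⟨φ, hφ⟩ := Module.Projective.exists_dual_eq_one F hz
  -- If `L ∧ L` is a line, it is spanned by `x ∧ y`, and `φ ∘ d` gives the coordinate.
  obtain ⟨r, hr⟩ := Submodule.mem_span_singleton.1 (hall (wedge F x y))
  have hcoord (w : ExteriorSquare F L) : w = φ (d w) • wedge F x y := by
    obtain ⟨t, rfl⟩ := Submodule.mem_span_singleton.1 (hall w)
    have h1 : r * φ (d e) = 1 := by
      rw [← smul_eq_mul, ← map_smul, ← map_smul, hr, hd, hφ]
    rw [← hr, map_smul, map_smul, smul_smul, smul_eq_mul, mul_assoc, mul_comm (φ (d e)), h1,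
      mul_one]
  have hcocycle {c : L →ₗ[F] L →ₗ[F] F} (hc : IsTwoCocycle c) (a b : L) :
      c a b = φ ⁅a, b⁆ * c x y := by
    obtain ⟨g, hg⟩ := exists_functional hc
    rw [← hg, hcoord (wedge F a b), map_smul, hd, hg, smul_eq_mul]
  have hlie (a b : L) : ⁅a, b⁆ = φ ⁅a, b⁆ • ⁅x, y⁆ := by
    have := congrArg d (hcoord (wedge F a b))
    rwa [map_smul, hd, hd] at this
  have hcen (a : L) : ⁅a, ⁅x, y⁆⁆ = 0 := by
    rw [hlie a, eq_zero_of_lie_eq_smul F hz (hlie a ⁅x, y⁆), zero_smul]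
  have hcen' (a b c : L) : ⁅a, ⁅b, c⁆⁆ = 0 := by
    rw [hlie b c, lie_smul, hcen, smul_zero]
  -- With `ω = dφ`, the forms `ω` and `ω(x, ·) ∧ ω(y, ·)` are cocycles, hence equal.
  have hω (a b : L) : φ ⁅a, b⁆ = φ ⁅x, a⁆ * φ ⁅y, b⁆ - φ ⁅y, a⁆ * φ ⁅x, b⁆ := by
    have h1 := hcocycle (isTwoCocycle_wedgeForm (φ := φ ∘ₗ lieBilin F L x)
      (ψ := φ ∘ₗ lieBilin F L y) (by simp [hcen']) (by simp [hcen'])) a b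
    have hyx : φ ⁅y, x⁆ = -1 := by rw [← lie_skew, map_neg, hφ]
    simpa [hφ, hyx] using h1.symm
  -- So `ω` has rank two, and `φ ∧ ω(x, ·)` is a cocycle that does not kill `⁅x, y⁆`.
  have h1 := hcocycle (isTwoCocycle_wedgeForm (φ := φ) (ψ := φ ∘ₗ lieBilin F L x)
    (by simp [hcen']) (fun a b c => by
      simp only [LinearMap.comp_apply, lieBilin_apply]
      rw [hω a b, hω b c, hω c a]
      ring)) ⁅x, y⁆ y
  have hzy : ⁅⁅x, y⁆, y⁆ = 0 := by rw [← lie_skew, hcen, neg_zero]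
  simp [hφ, hzy, hcen] at h1

lemma ExteriorSquare.commutatorHom_mem {d : ExteriorSquare F L →ₗ⁅F⁆ L}
    (hd : ∀ x y, d (wedge F x y) = ⁅x, y⁆) (w : ExteriorSquare F L) :
    d w ∈ lowerCentralSeries F L L 1 := by
  have hle : Submodule.span F (Set.range fun p : L × L => wedge F p.1 p.2) ≤
      (lowerCentralSeries F L L 1).toSubmodule.comap d.toLinearMap := by
    rw [Submodule.span_le]
    rintro _ ⟨p, rfl⟩
    change d (wedge F p.1 p.2) ∈ lowerCentralSeries F L L 1
    rw [hd]
    exact lie_mem_lowerCentralSeries_one p.1 p.2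
  rw [span_range_wedge] at hle
  exact hle Submodule.mem_top

lemma ExteriorSquare.wedge_commutatorHom_eq_zero {d : ExteriorSquare F L →ₗ⁅F⁆ L}
    (hd : ∀ x y, d (wedge F x y) = ⁅x, y⁆) {s : L} (hs : ∀ x : L, ⁅x, s⁆ = 0)
    (w : ExteriorSquare F L) : wedge F s (d w) = 0 := by
  have h : (wedgeBilin F L s) ∘ₗ d.toLinearMap = 0 := linearMap_ext fun x y => by
    change wedge F s (d (wedge F x y)) = 0
    rw [hd, wedge_lie_eq_zero hs]
  exact LinearMap.congr_fun h w

/-- If a nonzero element of `L²` is central and `dim L² ≤ 4`, then all forms `φ ⁅a, b⁆` on `L ∧ L`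
have rank at most three, hence at most two: the bracket of `L ∧ L` factors through the quotient of
`L²` by that central element. -/
lemma ExteriorSquare.plucker [FiniteDimensional F L]
    (hdim : finrank F (lowerCentralSeries F L L 1) ≤ 4) {s : L}
    (hsmem : s ∈ lowerCentralSeries F L L 1) (hs0 : s ≠ 0) (hs : ∀ x : L, ⁅x, s⁆ = 0)
    (φ : ExteriorSquare F L →ₗ[F] F) (a b c e : ExteriorSquare F L) :
    φ ⁅a, b⁆ * φ ⁅c, e⁆ - φ ⁅a, c⁆ * φ ⁅b, e⁆ + φ ⁅a, e⁆ * φ ⁅b, c⁆ = 0 := by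
  obtain ⟨d, hd, hbr⟩ := exists_commutatorHom (F := F) (L := L)
  have hdmem := commutatorHom_mem hd
  have hsw := wedge_commutatorHom_eq_zero hd hs
  -- Five vectors of `L²`, one of them `s`, are linearly dependent.
  let v : Fin 5 → lowerCentralSeries F L L 1 :=
    ![⟨d a, hdmem a⟩, ⟨d b, hdmem b⟩, ⟨d c, hdmem c⟩, ⟨d e, hdmem e⟩, ⟨s, hsmem⟩]
  have hv : ¬ LinearIndependent F v := fun hli => by
    have := hli.fintype_card_le_finrank
    rw [Fintype.card_fin] at this
    omega
  obtain ⟨t, ht, i, hi⟩ := Fintype.not_linearIndependent_iff.1 hv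
  have hrel : t 0 • d a + t 1 • d b + t 2 • d c + t 3 • d e + t 4 • s = 0 := by
    have := congrArg Subtype.val ht
    simpa [v, Fin.sum_univ_five] using this
  have hE (w : ExteriorSquare F L) :
      t 0 * φ ⁅a, w⁆ + t 1 * φ ⁅b, w⁆ + t 2 * φ ⁅c, w⁆ + t 3 * φ ⁅e, w⁆ = 0 := by
    have h0 := congrArg (fun u => φ (wedgeBilin F L u (d w))) hrel
    simpa [hsw, ← hbr] using h0
  have haa (w : ExteriorSquare F L) : φ ⁅w, w⁆ = 0 := by simp
  have hsk (w w' : ExteriorSquare F L) : φ ⁅w', w⁆ = -φ ⁅w, w'⁆ := by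
    rw [← lie_skew, map_neg]
  have hEa := hE a
  have hEb := hE b
  have hEc := hE c
  have hEe := hE e
  rw [haa, hsk a b, hsk a c, hsk a e] at hEa
  rw [haa, hsk b c, hsk b e] at hEb
  rw [haa, hsk c e] at hEc
  rw [haa] at hEe
  set P := φ ⁅a, b⁆ * φ ⁅c, e⁆ - φ ⁅a, c⁆ * φ ⁅b, e⁆ + φ ⁅a, e⁆ * φ ⁅b, c⁆
  have h0 : t 0 * P = 0 := by
    linear_combination φ ⁅c, e⁆ * hEb - φ ⁅b, e⁆ * hEc + φ ⁅b, c⁆ * hEe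
  have h1 : t 1 * P = 0 := by
    linear_combination -φ ⁅c, e⁆ * hEa + φ ⁅a, e⁆ * hEc - φ ⁅a, c⁆ * hEe
  have h2 : t 2 * P = 0 := by
    linear_combination φ ⁅b, e⁆ * hEa - φ ⁅a, e⁆ * hEb + φ ⁅a, b⁆ * hEe
  have h3 : t 3 * P = 0 := by
    linear_combination -φ ⁅b, c⁆ * hEa + φ ⁅a, c⁆ * hEb - φ ⁅a, b⁆ * hEc
  by_contra hne
  have h0' := (mul_eq_zero.1 h0).resolve_right hne
  have h1' := (mul_eq_zero.1 h1).resolve_right hne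
  have h2' := (mul_eq_zero.1 h2).resolve_right hne
  have h3' := (mul_eq_zero.1 h3).resolve_right hne
  have h4' : t 4 = 0 := by simpa [h0', h1', h2', h3', hs0] using hrel
  fin_cases i
  exacts [hi h0', hi h1', hi h2', hi h3', hi h4']

end ExteriorSquareCapable

theorem proposition3p3 {F : Type u} [Field F] {L : Type v} [LieRing L] [LieAlgebra F L]
    [FiniteDimensional F L] (hnil : LieRing.IsNilpotent L) (hdim : Module.finrank F L ≤ 6)
    (hnonab : ¬ IsLieAbelian L) :
    IsCapable F (ExteriorSquare F L) := by
  have hrank := finrank_lowerCentralSeries_one_add_two_le (F := F) hnonab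
  obtain ⟨s, hsmem, hs0, hs⟩ := exists_central_mem_lowerCentralSeries_one F hnonab
  refine isCapable_of_plucker ?_ (ExteriorSquare.exists_notMem_span_singleton hnonab)
    (ExteriorSquare.plucker (by omega) hsmem hs0 hs)
  obtain ⟨d, hd, hbr⟩ := ExteriorSquare.exists_commutatorHom (F := F) (L := L)
  intro a b c
  -- `⁅⁅a, b⁆, c⁆ = ⁅d a, d b⁆ ∧ d c`, where `⁅d a, d b⁆` lies in the second derived algebra.
  rw [hbr, LieHom.map_lie]
  exact ExteriorSquare.wedge_commutatorHom_eq_zero hd (fun x =>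
    lie_lie_lie_eq_zero_of_finrank_le_six (F := F) hnonab hdim x
      (ExteriorSquare.commutatorHom_mem hd a) (ExteriorSquare.commutatorHom_mem hd b)) c
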